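/- Let $X_1,X_2,\dots$ be independent positive random variables on a probability space, with distribution functions $F_j(x)=\mathbb P(X_j\le x)$ such that $F_j(x)>0$ for all $x>0$ and $F_j$ is strictly increasing on $(0,\infty)$. Let $c_1,c_2,\dots$ be positive constants, put $d_n=\sum_{j=1}^n c_j$, and let $\mu$ be a probability measure on $[0,1]$. Assume: ($\mathbf{H_1}$) as $n\to\infty$, $d_n\to\infty$, $\;\max_{j\le n}c_j/d_n\to 0$, and the measures $\mu_n=\sum_{j=1}^n \frac{c_j}{d_n}\,\delta_{\{j/n\}}$ on $[0,1]$ converge weakly to $\mu$; ($\mathbf{H_3}$) for some $\alpha>0$ and all $j$ and $x>0$, $$-\ln F_j(x)=c_j\,x^{-\alpha}\,(1+\delta_j(x)),$$ where the functions $\delta_j$ are continuous on $(0,\infty)$, $\delta_j(x)\to0$ as $x\to\infty$ uniformly in $j$, and there are constants $0<m<1$ and $0<M<\infty$ with $-m\le\delta_j(x)\le M$ for all $j$ and all $x>0$. Put $X_{n,j}=d_n^{-1/\alpha}X_j$ for $j\le n$. Then $\operatorname{argmax}_{j\le n}X_{n,j}=\operatorname{argmax}_{j\le n}X_j$ (as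 sets of maximizing indices), and if, for each $n$, $J_n\in\{1,\dots,n\}$ is almost surely an index at which $\max_{j\le n}X_{n,j}$ is attained, then $J_n/n$ is a random variable (measurable up to null sets) and, as $n\to\infty$, converges in distribution to $\mu$. -/

import Mathlib

open MeasureTheory ProbabilityTheory Filter Topology

noncomputable section

namespace ArgmaxLimit

/-- The partial sums `d_n = c_1 + ... + c_n`. -/
def d (c : ℕ+ → ℝ) (n : ℕ+) : ℝ := ∑ j ∈ Finset.Icc 1 n, c j

/-- The maximum `max_{j ≤ n} c_j`. -/
def maxCoeff (c : ℕ+ → ℝ) (n : ℕ+) : ℝ :=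
  (Finset.Icc 1 n).sup' (Finset.nonempty_Icc.mpr (one_le)) c

/-- The point `j / n` of `[0, 1]`; the truncation at `1` is inactive for `j ≤ n`. -/
def gridPoint (n j : ℕ+) : unitInterval :=
  ⟨min ((j : ℝ) / (n : ℝ)) 1, le_min (by positivity) zero_le_one, min_le_right _ _⟩

/-- The discrete measure `μ_n = ∑_{j ≤ n} (c_j / d_n) δ_{j/n}` on `[0, 1]`. -/
def weightMeasure (c : ℕ+ → ℝ) (n : ℕ+) : FiniteMeasure unitInterval :=
  ⟨∑ j ∈ Finset.Icc 1 n, (c j / d c n).toNNReal • Measure.dirac (gridPoint n j), inferInstance⟩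

/-- Condition on the weights: `d_n → ∞`, `max_{j ≤ n} c_j / d_n → 0`, and `μ_n` converges weakly
to `μ`. -/
structure CondH1 (c : ℕ+ → ℝ) (μ : ProbabilityMeasure unitInterval) : Prop where
  tendsto_sum : Tendsto (d c) atTop atTop
  tendsto_max : Tendsto (fun n => maxCoeff c n / d c n) atTop (𝓝 0)
  tendsto_weight : Tendsto (weightMeasure c) atTop (𝓝 μ.toFiniteMeasure)

/-- Tail condition with `r(x) = x ^ (-α)`: for distribution functions `F j`, one has
`-ln F_j(x) = c_j x ^ (-α) (1 + δ_j(x))` for `x > 0`, where the `δ_j` are continuous on `(0, ∞)`,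
tend to `0` at infinity uniformly in `j`, and satisfy `-m ≤ δ_j ≤ M` for some positive constants
`m < 1` and `M`. -/
structure CondH3 (F : ℕ+ → ℝ → ℝ) (c : ℕ+ → ℝ) (α : ℝ) (δ : ℕ+ → ℝ → ℝ) : Prop where
  neg_log_eq : ∀ j, ∀ x : ℝ, 0 < x → -Real.log (F j x) = c j * x ^ (-α) * (1 + δ j x)
  continuousOn : ∀ j, ContinuousOn (δ j) (Set.Ioi 0)
  tendsto_zero : TendstoUniformly (fun (x : ℝ) (j : ℕ+) => δ j x) (fun _ => 0) atTop
  bounded : ∃ m M : ℝ, 0 < m ∧ m < 1 ∧ 0 < M ∧ ∀ j, ∀ x : ℝ, 0 < x → -m ≤ δ j x ∧ δ j x ≤ M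

/-- The rescaled triangular array `X_{n,j} = d_n ^ (-1/α) X_j`. -/
def scaled {Ω : Type*} (c : ℕ+ → ℝ) (α : ℝ) (X : ℕ+ → Ω → ℝ) (n j : ℕ+) (ω : Ω) : ℝ :=
  d c n ^ (-(1 / α)) * X j ω

/-- The set of indices `k ≤ n` at which `x_1, ..., x_n` attains its maximum. -/
def argmaxSet (n : ℕ+) (x : ℕ+ → ℝ) : Set ℕ+ :=
  {k | k ≤ n ∧ ∀ j ≤ n, x j ≤ x k}

end ArgmaxLimit

end

/-!
Write `p_k` for the probability that `X k` is the largest among `X 1, ..., X n`. The tail condition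
makes the distribution functions continuous on `(0, ∞)`, so ties are null events
(`ArgmaxLimit.ae_injective`); hence the maximizing index is a.s. unique, and `J_n / n` has the law
`∑ p_k δ_{k/n}`. This is to be compared with `μ_n = ∑ (c_k / d_n) δ_{k/n}`. Both are probability
measures, so it suffices to bound `p_k` from below by `(1 - η) c_k / d_n` uniformly in `k`: the
ℓ¹ distance of the two laws is then at most `2 η` (`ArgmaxLimit.abs_sum_mul_sub_sum_mul_le`).

For the lower bound, independence gives `p_k = ∫ ∏_{j ≠ k} F_j dF_k`
(`ArgmaxLimit.measure_forall_le_eq_lintegral`). Beyond a fixed level `R`, where `|δ_j| ≤ ε` for all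
`j`, the integrand is at least `exp (-A x ^ (-α))` with `A = (1 + ε) d_n`, and
`F_k ≤ exp (-b x ^ (-α))` with `b = (1 - ε) c_k`. The layer cake formula turns these into
`p_k ≥ ∫ (1 - t ^ (b / A)) dt` over `t ∈ (e^{-y}, 1)`, where `y = A R ^ (-α)`, and this is at least
`b / (A + b) * (1 - (1 + y) e^{-y})` (`ArgmaxLimit.le_measure_forall_le`). The cutoff costs only a
*relative* error, which vanishes since `d_n → ∞`, and `b` is negligible against `A` since
`max c_j / d_n → 0`; so the bound is asymptotically `c_k / d_n`
(`ArgmaxLimit.eventually_le_measure_argmax`).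
-/

namespace ArgmaxLimit

/-! ### A Laplace-type integral -/

theorem le_integral_one_sub_rpow {β y : ℝ} (hβ : 0 < β) :
    β / (1 + β) * (1 - (1 + y) * Real.exp (-y)) ≤
      ∫ t in Real.exp (-y)..1, (1 - t ^ β) := by
  have hint : IntervalIntegrable (fun t : ℝ => t ^ β) volume (Real.exp (-y)) 1 :=
    intervalIntegral.intervalIntegrable_rpow' (by linarith)
  rw [intervalIntegral.integral_sub intervalIntegrable_const hint,
    intervalIntegral.integral_const, integral_rpow (Or.inl (by linarith)), Real.one_rpow,
    Real.rpow_add_one (Real.exp_pos _).ne', ← Real.exp_mul]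
  have h1 : 1 - y * β ≤ Real.exp (-y * β) := by
    have := Real.add_one_le_exp (-y * β)
    linarith
  have h2 : (0 : ℝ) < β + 1 := by linarith
  rw [add_comm 1 β, div_mul_eq_mul_div, smul_eq_mul, mul_one, ← sub_nonneg]
  have : (1 - Real.exp (-y) - (1 - Real.exp (-y * β) * Real.exp (-y)) / (β + 1)) -
      β * (1 - (1 + y) * Real.exp (-y)) / (β + 1) =
      Real.exp (-y) * (Real.exp (-y * β) - (1 - y * β)) / (β + 1) := by
    field_simp
    ring
  rw [this]
  have := Real.exp_pos (-y)
  have : 0 ≤ Real.exp (-y * β) - (1 - y * β) := by linarith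
  positivity

/-- If `f ≥ 0` exceeds the levels `t ∈ (e^{-y}, 1)` with probability at least `1 - t ^ β`, the layer
cake formula bounds its integral from below. -/
theorem le_lintegral_of_one_sub_rpow_le {E : Type*} [MeasurableSpace E] {ν : Measure E}
    {f : E → ℝ} (hf : Measurable f) (hf0 : ∀ x, 0 ≤ f x) {β y : ℝ} (hβ : 0 < β) (hy : 0 ≤ y)
    (h : ∀ t ∈ Set.Ioo (Real.exp (-y)) 1, ENNReal.ofReal (1 - t ^ β) ≤ ν {x | t < f x}) :
    ENNReal.ofReal (β / (1 + β) * (1 - (1 + y) * Real.exp (-y))) ≤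
      ∫⁻ x, ENNReal.ofReal (f x) ∂ν := by
  have hle : Real.exp (-y) ≤ 1 := Real.exp_le_one_iff.mpr (by linarith)
  have hint : IntervalIntegrable (fun t : ℝ => 1 - t ^ β) volume (Real.exp (-y)) 1 :=
    intervalIntegrable_const.sub (intervalIntegral.intervalIntegrable_rpow' (by linarith))
  have hint' := (intervalIntegrable_iff_integrableOn_Ioo_of_le hle).mp hint
  calc _ ≤ ENNReal.ofReal (∫ t in Real.exp (-y)..1, (1 - t ^ β)) :=
        ENNReal.ofReal_le_ofReal (le_integral_one_sub_rpow hβ)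
    _ = ∫⁻ t in Set.Ioo (Real.exp (-y)) 1, ENNReal.ofReal (1 - t ^ β) := by
        rw [intervalIntegral.integral_of_le hle, integral_Ioc_eq_integral_Ioo,
          ofReal_integral_eq_lintegral_ofReal hint']
        filter_upwards [ae_restrict_mem measurableSet_Ioo] with t ht
        have := Real.rpow_le_one ((Real.exp_pos _).trans ht.1).le ht.2.le hβ.le
        simpa using this
    _ ≤ ∫⁻ t in Set.Ioo (Real.exp (-y)) 1, ν {x | t < f x} :=
        setLIntegral_mono' measurableSet_Ioo h
    _ ≤ ∫⁻ t in Set.Ioi 0, ν {x | t < f x} :=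
        lintegral_mono_set fun t ht => (Real.exp_pos _).trans ht.1
    _ = _ := (lintegral_eq_lintegral_meas_lt ν (ae_of_all _ hf0) hf.aemeasurable).symm

/-! ### Independent variables without atoms -/

theorem nullSingletonClass_of_continuousOn_cdf {ν : Measure ℝ} [IsProbabilityMeasure ν]
    (h0 : ν (Set.Iic 0) = 0) (hc : ContinuousOn (cdf ν) (Set.Ioi 0)) : NullSingletonClass ν where
  measure_singleton x := by
    rcases le_or_gt x 0 with hx | hx
    · exact measure_mono_null (Set.singleton_subset_iff.mpr hx) h0
    · rw [← measure_cdf ν, StieltjesFunction.measure_singleton,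
        ((hc.continuousAt (Ioi_mem_nhds hx)).continuousWithinAt).leftLim_eq, sub_self,
        ENNReal.ofReal_zero]

theorem measure_eq_eq_zero_of_indepFun {Ω : Type*} [MeasurableSpace Ω]
    {P : Measure Ω} [IsProbabilityMeasure P] {Y Z : Ω → ℝ} (hY : Measurable Y) (hZ : Measurable Z)
    (h : IndepFun Y Z P) [NullSingletonClass (P.map Z)] : P {ω | Y ω = Z ω} = 0 := by
  have := Measure.isProbabilityMeasure_map (μ := P) hZ.aemeasurable
  have hD : MeasurableSet {p : ℝ × ℝ | p.1 = p.2} :=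
    measurableSet_eq_fun measurable_fst measurable_snd
  have := Measure.map_apply (μ := P) (hY.prodMk hZ) hD
  rw [(indepFun_iff_map_prod_eq_prod_map_map hY.aemeasurable hZ.aemeasurable).mp h,
    Measure.prod_apply hD] at this
  refine this.symm.trans ((lintegral_congr fun x => ?_).trans lintegral_zero)
  have : Prod.mk x ⁻¹' {p : ℝ × ℝ | p.1 = p.2} = {x} := by
    ext z
    simp [eq_comm]
  rw [this, measure_singleton]

/-- Conditioning on `X k`: it dominates the other variables with probability
`∫ ∏ j ∈ S, F j dF k`. -/
theorem measure_forall_le_eq_lintegral {Ω ι : Type*} [MeasurableSpace Ω] {P : Measure Ω}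
    [IsProbabilityMeasure P] {X : ι → Ω → ℝ} (hX : ∀ j, Measurable (X j)) (hind : iIndepFun X P)
    {S : Finset ι} {k : ι} (hk : k ∉ S) :
    P {ω | ∀ j ∈ S, X j ω ≤ X k ω} =
      ∫⁻ x, ∏ j ∈ S, P.map (X j) (Set.Iic x) ∂P.map (X k) := by
  have hXS : Measurable fun ω (j : S) => X j ω := measurable_pi_lambda _ fun j => hX j
  have := Measure.isProbabilityMeasure_map (μ := P) hXS.aemeasurable
  have hkS : IndepFun (X k) (fun ω (j : S) => X j ω) P :=
    (hind.indepFun_finset {k} S (by simpa using hk) hX).comp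
      (measurable_pi_apply (⟨k, by simp⟩ : ({k} : Finset ι))) measurable_id
  have hD : MeasurableSet {p : ℝ × (S → ℝ) | ∀ j, p.2 j ≤ p.1} := by
    rw [Set.ofPred_forall]
    exact MeasurableSet.iInter fun j => measurableSet_le (by fun_prop) measurable_fst
  have key := Measure.map_apply (μ := P) ((hX k).prodMk hXS) hD
  rw [(indepFun_iff_map_prod_eq_prod_map_map (hX k).aemeasurable hXS.aemeasurable).mp hkS,
    Measure.prod_apply hD] at key
  have hset : {ω | ∀ j ∈ S, X j ω ≤ X k ω} =
      (fun ω => (X k ω, fun j : S => X j ω)) ⁻¹' {p : ℝ × (S → ℝ) | ∀ j, p.2 j ≤ p.1} := by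
    ext ω
    simp
  rw [hset, ← key]
  refine lintegral_congr fun x => ?_
  rw [Measure.map_apply hXS (measurable_prodMk_left hD)]
  have : (fun ω (j : S) => X j ω) ⁻¹' (Prod.mk x ⁻¹' {p : ℝ × (S → ℝ) | ∀ j, p.2 j ≤ p.1}) =
      ⋂ j ∈ S, X j ⁻¹' Set.Iic x := by
    ext ω
    simp
  rw [this, hind.measure_inter_preimage_eq_mul S fun _ _ => measurableSet_Iic]
  exact Finset.prod_congr rfl fun j _ => (Measure.map_apply (hX j) measurableSet_Iic).symm

/-! ### The probability that a given index is maximal -/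

/-- If, beyond `R`, the distribution functions satisfy `F j x ≥ exp (-(a j) x ^ (-α))` for `j ∈ S`
and `F k x ≤ exp (-b x ^ (-α))`, then `X k` dominates all `X j`, `j ∈ S`, with probability at least
`b / (A + b)` up to a factor that tends to `1` as `A → ∞`, where `A ≥ ∑ j ∈ S, a j`. -/
theorem le_measure_forall_le {Ω ι : Type*} [MeasurableSpace Ω] {P : Measure Ω}
    [IsProbabilityMeasure P] {X : ι → Ω → ℝ} (hX : ∀ j, Measurable (X j)) (hind : iIndepFun X P)
    {S : Finset ι} {k : ι} (hk : k ∉ S) {α R A b : ℝ} {a : ι → ℝ} (hα : 0 < α) (hR : 0 < R)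
    (hA : 0 < A) (hb : 0 < b) (haA : ∑ j ∈ S, a j ≤ A)
    (hlow : ∀ j ∈ S, ∀ x, R ≤ x → Real.exp (-(a j * x ^ (-α))) ≤ cdf (P.map (X j)) x)
    (hup : ∀ x, R ≤ x → cdf (P.map (X k)) x ≤ Real.exp (-(b * x ^ (-α)))) :
    ENNReal.ofReal (b / A / (1 + b / A) *
        (1 - (1 + A * R ^ (-α)) * Real.exp (-(A * R ^ (-α))))) ≤
      P {ω | ∀ j ∈ S, X j ω ≤ X k ω} := by
  have hprob : ∀ j, IsProbabilityMeasure (P.map (X j)) := fun j =>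
    Measure.isProbabilityMeasure_map (hX j).aemeasurable
  rw [measure_forall_le_eq_lintegral hX hind hk]
  set f : ℝ → ℝ := (Set.Ici R).indicator fun x => Real.exp (-(A * x ^ (-α))) with hf
  have hfm : Measurable f := Measurable.indicator (by fun_prop) measurableSet_Ici
  have hf0 : ∀ x, 0 ≤ f x := fun x => Set.indicator_nonneg (fun _ _ => (Real.exp_pos _).le) x
  refine (le_lintegral_of_one_sub_rpow_le (ν := P.map (X k)) hfm hf0 (div_pos hb hA)
    (y := A * R ^ (-α)) (by positivity) ?_).trans (lintegral_mono fun x => ?_)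
  · rintro t ⟨ht, ht1⟩
    have ht0 : 0 < t := (Real.exp_pos _).trans ht
    -- `x₀` is the point at which `exp (-A x ^ (-α))` takes the value `t`.
    set s : ℝ := -Real.log t / A with hs
    have hs0 : 0 < s := div_pos (neg_pos.mpr (Real.log_neg ht0 ht1)) hA
    have hAs : A * s = -Real.log t := by rw [hs]; field_simp
    have hsR : s < R ^ (-α) := by
      have := (Real.lt_log_iff_exp_lt ht0).mpr ht
      rw [← mul_lt_mul_iff_right₀ hA]
      linarith
    set x₀ : ℝ := s ^ (-α)⁻¹ with hx₀
    have hx₀s : x₀ ^ (-α) = s := Real.rpow_inv_rpow hs0.le (by linarith)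
    have hx₀0 : 0 < x₀ := Real.rpow_pos_of_pos hs0 _
    have hRx₀ : R ≤ x₀ := by
      by_contra! hlt
      have := Real.rpow_lt_rpow_of_neg hx₀0 hlt (neg_lt_zero.mpr hα)
      rw [hx₀s] at this
      linarith
    calc ENNReal.ofReal (1 - t ^ (b / A))
        ≤ ENNReal.ofReal (1 - cdf (P.map (X k)) x₀) := by
          refine ENNReal.ofReal_le_ofReal (sub_le_sub_left ((hup x₀ hRx₀).trans_eq ?_) 1)
          rw [hx₀s, Real.rpow_def_of_pos ht0, hs]
          congr 1
          ring
      _ = P.map (X k) (Set.Ioi x₀) := by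
          rw [← Set.compl_Iic, prob_compl_eq_one_sub measurableSet_Iic, ← ofReal_cdf,
            ENNReal.ofReal_sub _ (cdf_nonneg _ _), ENNReal.ofReal_one]
      _ ≤ P.map (X k) {x | t < f x} := by
          refine measure_mono fun x (hx : x₀ < x) => ?_
          have := Real.rpow_lt_rpow_of_neg hx₀0 hx (neg_lt_zero.mpr hα)
          rw [hx₀s] at this
          rw [Set.mem_ofPred_eq, hf, Set.indicator_of_mem (Set.mem_Ici.mpr (hRx₀.trans hx.le)),
            ← Real.log_lt_iff_lt_exp ht0]
          have := mul_lt_mul_of_pos_left this hA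
          linarith
  · by_cases hx : R ≤ x
    · rw [hf, Set.indicator_of_mem (Set.mem_Ici.mpr hx)]
      simp_rw [← ofReal_cdf]
      rw [← ENNReal.ofReal_prod_of_nonneg fun j _ => cdf_nonneg _ _]
      refine ENNReal.ofReal_le_ofReal ?_
      calc Real.exp (-(A * x ^ (-α))) ≤ Real.exp (∑ j ∈ S, -(a j * x ^ (-α))) := by
            rw [Finset.sum_neg_distrib, ← Finset.sum_mul]
            have := Real.rpow_nonneg (hR.le.trans hx) (-α)
            gcongr
        _ = ∏ j ∈ S, Real.exp (-(a j * x ^ (-α))) := Real.exp_sum _ _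
        _ ≤ _ := Finset.prod_le_prod (fun j _ => (Real.exp_pos _).le) fun j hj => hlow j hj x hx
    · rw [hf, Set.indicator_of_notMem (by simpa using hx)]
      simp

/-! ### Total variation and almost sure index choices -/

/-- If `p` and `w` are weights of total mass `1`, a one-sided bound
`(1 - η) w ≤ p` controls the difference of the two averages. -/
theorem abs_sum_mul_sub_sum_mul_le {ι : Type*} {S : Finset ι} {p w g : ι → ℝ} {η C : ℝ}
    (hη : 0 ≤ η) (hw : ∀ k ∈ S, 0 ≤ w k) (hp1 : ∑ k ∈ S, p k = 1) (hw1 : ∑ k ∈ S, w k = 1)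
    (h : ∀ k ∈ S, (1 - η) * w k ≤ p k) (hg : ∀ k ∈ S, |g k| ≤ C) :
    |∑ k ∈ S, p k * g k - ∑ k ∈ S, w k * g k| ≤ 2 * η * C := by
  have key : ∀ k ∈ S, |p k * g k - w k * g k| ≤ (p k - w k + 2 * η * w k) * C := by
    intro k hk
    rw [← sub_mul, abs_mul]
    have h1 := h k hk
    have h2 := mul_nonneg hη (hw k hk)
    exact mul_le_mul (abs_le.mpr ⟨by linarith, by linarith⟩) (hg k hk) (abs_nonneg _)
      (by linarith)
  rw [← Finset.sum_sub_distrib]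
  refine (Finset.abs_sum_le_sum_abs _ _).trans ((Finset.sum_le_sum key).trans_eq ?_)
  rw [← Finset.sum_mul, Finset.sum_add_distrib, Finset.sum_sub_distrib, ← Finset.mul_sum, hp1, hw1]
  ring

section Selection

variable {Ω ι : Type*} [MeasurableSpace Ω] {P : Measure Ω}
  {S : Finset ι} {A : ι → Set Ω} {J : Ω → ι}

/-- An index choice `J` that a.e. agrees with the measurable events `A k` is measurable up to null
sets, whatever its values on the exceptional set. -/
theorem nullMeasurable_comp_of_ae_mem_iff [Countable ι] {E : Type*} [MeasurableSpace E]
    (hA : ∀ k, MeasurableSet (A k)) (hJ : ∀ᵐ ω ∂P, ∀ k, ω ∈ A k ↔ J ω = k) (φ : ι → E) :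
    NullMeasurable (fun ω => φ (J ω)) P := by
  intro s _
  refine NullMeasurableSet.congr (s := ⋃ k ∈ φ ⁻¹' s, A k)
    (MeasurableSet.biUnion (Set.to_countable _) fun k _ => hA k).nullMeasurableSet ?_
  filter_upwards [hJ] with ω hω
  refine propext ?_
  change ω ∈ (⋃ k ∈ φ ⁻¹' s, A k) ↔ φ (J ω) ∈ s
  simp [hω]

theorem integral_comp_of_ae_mem_iff [IsFiniteMeasure P] (hA : ∀ k, MeasurableSet (A k))
    (hJ : ∀ᵐ ω ∂P, ∀ k, ω ∈ A k ↔ J ω = k) (hJS : ∀ᵐ ω ∂P, J ω ∈ S) (g : ι → ℝ) :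
    ∫ ω, g (J ω) ∂P = ∑ k ∈ S, P.real (A k) * g k := by
  classical
  have : (fun ω => g (J ω)) =ᵐ[P] fun ω => ∑ k ∈ S, (A k).indicator (fun _ => g k) ω := by
    filter_upwards [hJ, hJS] with ω hω hωS
    simp [Set.indicator_apply, hω, hωS]
  rw [integral_congr_ae this,
    integral_finsetSum _ fun k _ => (integrable_const _).indicator (hA k)]
  simp [integral_indicator_const _ (hA _)]

end Selection

/-! ### Consequences of the tail condition -/

theorem d_pos {c : ℕ+ → ℝ} (hc : ∀ j, 0 < c j) (n : ℕ+) : 0 < d c n :=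
  Finset.sum_pos (fun j _ => hc j) (Finset.nonempty_Icc.mpr one_le)

theorem argmaxSet_scaled {Ω : Type*} {c : ℕ+ → ℝ} (hc : ∀ j, 0 < c j) (α : ℝ) (X : ℕ+ → Ω → ℝ)
    (n : ℕ+) (ω : Ω) :
    argmaxSet n (fun j => scaled c α X n j ω) = argmaxSet n (fun j => X j ω) := by
  have := Real.rpow_pos_of_pos (d_pos hc n) (-(1 / α))
  simp only [argmaxSet, scaled, mul_le_mul_iff_right₀ this]

theorem integral_weightMeasure {c : ℕ+ → ℝ} (hc : ∀ j, 0 < c j) (n : ℕ+) (f : unitInterval → ℝ)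
    (hf : Continuous f) :
    ∫ x, f x ∂(weightMeasure c n : Measure unitInterval) =
      ∑ j ∈ Finset.Icc 1 n, c j / d c n * f (gridPoint n j) := by
  change ∫ x, f x ∂(∑ j ∈ Finset.Icc 1 n,
    (c j / d c n).toNNReal • Measure.dirac (gridPoint n j)) = _
  rw [integral_finsetSum_measure fun j _ =>
    hf.integrable_of_hasCompactSupport (HasCompactSupport.of_compactSpace f)]
  refine Finset.sum_congr rfl fun j _ => ?_
  rw [integral_smul_nnreal_measure, integral_dirac, NNReal.smul_def,
    Real.coe_toNNReal _ (div_pos (hc j) (d_pos hc n)).le, smul_eq_mul]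

theorem CondH3.eq_exp {F : ℕ+ → ℝ → ℝ} {c : ℕ+ → ℝ} {α : ℝ} {δ : ℕ+ → ℝ → ℝ}
    (h : CondH3 F c α δ) (hF : ∀ j, ∀ x : ℝ, 0 < x → 0 < F j x) (j : ℕ+) {x : ℝ} (hx : 0 < x) :
    F j x = Real.exp (-(c j * x ^ (-α) * (1 + δ j x))) := by
  rw [← h.neg_log_eq j x hx, neg_neg, Real.exp_log (hF j x hx)]

theorem CondH3.continuousOn_Ioi {F : ℕ+ → ℝ → ℝ} {c : ℕ+ → ℝ} {α : ℝ} {δ : ℕ+ → ℝ → ℝ}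
    (h : CondH3 F c α δ) (hF : ∀ j, ∀ x : ℝ, 0 < x → 0 < F j x) (j : ℕ+) :
    ContinuousOn (F j) (Set.Ioi 0) := by
  refine ContinuousOn.congr (f := fun x => Real.exp (-(c j * x ^ (-α) * (1 + δ j x)))) ?_
    fun x hx => h.eq_exp hF j hx
  have hpow : ContinuousOn (fun x : ℝ => x ^ (-α)) (Set.Ioi 0) := fun x hx =>
    (Real.continuousAt_rpow_const x _ (Or.inl (ne_of_gt hx))).continuousWithinAt
  exact ((continuousOn_const.mul hpow).mul
    (continuousOn_const.add (h.continuousOn j))).neg.rexp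

/-- Continuity of the distribution functions makes ties null events. -/
theorem ae_injective {Ω : Type*} [MeasurableSpace Ω] {P : Measure Ω} [IsProbabilityMeasure P]
    {X : ℕ+ → Ω → ℝ} (hX : ∀ j, Measurable (X j)) (hind : iIndepFun X P)
    (hX_pos : ∀ j, ∀ᵐ ω ∂P, 0 < X j ω)
    (hcont : ∀ j, ContinuousOn (cdf (P.map (X j))) (Set.Ioi 0)) :
    ∀ᵐ ω ∂P, Function.Injective fun j => X j ω := by
  have hprob : ∀ j, IsProbabilityMeasure (P.map (X j)) := fun j =>
    Measure.isProbabilityMeasure_map (hX j).aemeasurable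
  have hatom : ∀ j, NullSingletonClass (P.map (X j)) := fun j => by
    refine nullSingletonClass_of_continuousOn_cdf ?_ (hcont j)
    rw [Measure.map_apply (hX j) measurableSet_Iic]
    simpa [ae_iff, Set.preimage, Set.mem_Iic] using hX_pos j
  have : ∀ᵐ ω ∂P, ∀ i j, i ≠ j → X i ω ≠ X j ω := by
    simp only [ae_all_iff]
    intro i j hij
    have := measure_eq_eq_zero_of_indepFun (hX i) (hX j) (hind.indepFun hij)
    simpa [ae_iff] using this
  filter_upwards [this] with ω hω i j hij
  by_contra hne
  exact hω i j hne hij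

/-! ### Lower bound for the law of the maximizing index -/

/-- Eventually, uniformly in `k ≤ n`, the index `k` is maximal with probability at least
`(1 - η) c_k / d_n`. -/
theorem eventually_le_measure_argmax {Ω : Type*} [MeasurableSpace Ω] {P : Measure Ω}
    [IsProbabilityMeasure P] {X : ℕ+ → Ω → ℝ} (hX : ∀ j, Measurable (X j)) (hind : iIndepFun X P)
    (hF_pos : ∀ j, ∀ x : ℝ, 0 < x → 0 < cdf (P.map (X j)) x)
    {c : ℕ+ → ℝ} (hc : ∀ j, 0 < c j) (hd : Tendsto (d c) atTop atTop)
    (hmax : Tendsto (fun n => maxCoeff c n / d c n) atTop (𝓝 0)) {α : ℝ} (hα : 0 < α)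
    {δ : ℕ+ → ℝ → ℝ} (hH3 : CondH3 (fun j x => cdf (P.map (X j)) x) c α δ)
    {η : ℝ} (hη : 0 < η) (hη1 : η < 1) :
    ∀ᶠ n in atTop, ∀ k ≤ n,
      (1 - η) * (c k / d c n) ≤ P.real {ω | k ∈ argmaxSet n fun j => X j ω} := by
  -- `η = 4 ε` absorbs the total loss, as `(1 - ε) ^ 2 / (1 + 2 ε) ≥ 1 - 4 ε`.
  obtain ⟨ε, hε, rfl⟩ : ∃ ε, 0 < ε ∧ η = 4 * ε := ⟨η / 4, by linarith, by ring⟩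
  obtain ⟨R, hR, hδ⟩ : ∃ R : ℝ, 0 < R ∧ ∀ x, R ≤ x → ∀ j, |δ j x| < ε := by
    obtain ⟨R, hR⟩ := eventually_atTop.mp (Metric.tendstoUniformly_iff.mp hH3.tendsto_zero ε hε)
    exact ⟨max R 1, by positivity, fun x hx j => by
      simpa [Real.dist_eq] using hR x ((le_max_left _ _).trans hx) j⟩
  have hRα : 0 < R ^ (-α) := Real.rpow_pos_of_pos hR _
  -- The correction factor of `le_measure_forall_le` tends to `1`.
  have hfactor : ∀ᶠ n in atTop, 1 - ε ≤ 1 - (1 + (1 + ε) * d c n * R ^ (-α)) *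
      Real.exp (-((1 + ε) * d c n * R ^ (-α))) := by
    have hy : Tendsto (fun n => (1 + ε) * d c n * R ^ (-α)) atTop atTop :=
      (hd.const_mul_atTop (by positivity)).atTop_mul_const hRα
    have hlim : Tendsto (fun y : ℝ => (1 + y) * Real.exp (-y)) atTop (𝓝 0) := by
      have h0 := Real.tendsto_pow_mul_exp_neg_atTop_nhds_zero 0
      have h1 := Real.tendsto_pow_mul_exp_neg_atTop_nhds_zero 1
      simpa [add_mul] using h0.add h1
    filter_upwards [(hlim.comp hy).eventually_le_const hε] with n hn
    exact sub_le_sub_left hn 1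
  filter_upwards [hfactor, hmax.eventually_le_const hε] with n hq hmaxn k hkn
  have hD := d_pos hc n
  have hck : c k ≤ ε * d c n :=
    (Finset.le_sup' c (Finset.mem_Icc.mpr ⟨one_le, hkn⟩)).trans ((div_le_iff₀ hD).mp hmaxn)
  have hsum : ∑ j ∈ (Finset.Icc 1 n).erase k, (1 + ε) * c j ≤ (1 + ε) * d c n := by
    rw [← Finset.mul_sum]
    refine mul_le_mul_of_nonneg_left ?_ (by positivity)
    exact Finset.sum_le_sum_of_subset_of_nonneg (Finset.erase_subset _ _) fun j _ _ => (hc j).le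
  have hck0 := hc k
  have key := le_measure_forall_le hX hind (Finset.notMem_erase k (Finset.Icc 1 n)) hα hR
    (A := (1 + ε) * d c n) (b := (1 - ε) * c k) (a := fun j => (1 + ε) * c j) (by positivity)
    (mul_pos (by linarith) hck0) hsum
    (fun j _ x hx => by
      have hx0 := hR.trans_le hx
      have := mul_pos (hc j) (Real.rpow_pos_of_pos hx0 (-α))
      rw [hH3.eq_exp hF_pos j hx0]
      have := (abs_lt.mp (hδ x hx j)).2
      refine Real.exp_le_exp.mpr (neg_le_neg ?_)
      nlinarith)
    (fun x hx => by
      have hx0 := hR.trans_le hx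
      have := mul_pos (hc k) (Real.rpow_pos_of_pos hx0 (-α))
      rw [hH3.eq_exp hF_pos k hx0]
      have := (abs_lt.mp (hδ x hx k)).1
      refine Real.exp_le_exp.mpr (neg_le_neg ?_)
      nlinarith)
  have hset : {ω | ∀ j ∈ (Finset.Icc 1 n).erase k, X j ω ≤ X k ω} =
      {ω | k ∈ argmaxSet n fun j => X j ω} := by
    ext ω
    constructor
    · refine fun h => ⟨hkn, fun j hj => ?_⟩
      rcases eq_or_ne j k with rfl | hjk
      · exact le_rfl
      · exact h j (Finset.mem_erase.mpr ⟨hjk, Finset.mem_Icc.mpr ⟨one_le, hj⟩⟩)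
    · exact fun h j hj => h.2 j (Finset.mem_Icc.mp (Finset.mem_of_mem_erase hj)).2
  rw [hset, ENNReal.ofReal_le_iff_le_toReal (measure_ne_top _ _)] at key
  refine le_trans ?_ key
  have hb : 0 < (1 - ε) * c k := mul_pos (by linarith) hck0
  have hA : 0 < (1 + ε) * d c n := by positivity
  have hratio : (1 - ε) * c k / ((1 + 2 * ε) * d c n) ≤
      (1 - ε) * c k / ((1 + ε) * d c n) / (1 + (1 - ε) * c k / ((1 + ε) * d c n)) := by
    rw [one_add_div hA.ne', div_div_div_cancel_right₀ hA.ne']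
    refine div_le_div_of_nonneg_left hb.le (by positivity) ?_
    nlinarith
  refine le_trans ?_ (mul_le_mul hratio hq (by linarith) (by positivity))
  rw [div_mul_eq_mul_div, mul_div_assoc', div_le_div_iff₀ hD (by positivity)]
  have h1 : (1 - 4 * ε) * (1 + 2 * ε) ≤ (1 - ε) * (1 - ε) := by nlinarith
  have h2 := mul_le_mul_of_nonneg_right h1 (mul_pos hck0 hD).le
  linarith

end ArgmaxLimit

/-! ### Convergence in distribution -/

theorem theorem2 {Ω : Type*} [MeasurableSpace Ω] (P : Measure Ω) [IsProbabilityMeasure P]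
    (X : ℕ+ → Ω → ℝ) (hX_meas : ∀ j, Measurable (X j)) (hX_indep : iIndepFun X P)
    (hX_pos : ∀ j, ∀ᵐ ω ∂P, 0 < X j ω)
    (hF_pos : ∀ j, ∀ x : ℝ, 0 < x → 0 < cdf (P.map (X j)) x)
    (hF_strict : ∀ j, StrictMonoOn (cdf (P.map (X j))) (Set.Ioi 0))
    (c : ℕ+ → ℝ) (hc : ∀ j, 0 < c j) (μ : ProbabilityMeasure unitInterval)
    (hH1 : ArgmaxLimit.CondH1 c μ)
    (α : ℝ) (hα : 0 < α) (δ : ℕ+ → ℝ → ℝ)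
    (hH3 : ArgmaxLimit.CondH3 (fun j x => cdf (P.map (X j)) x) c α δ) :
    (∀ (n : ℕ+) (ω : Ω),
      ArgmaxLimit.argmaxSet n (fun j => ArgmaxLimit.scaled c α X n j ω) =
        ArgmaxLimit.argmaxSet n (fun j => X j ω)) ∧
    (∀ J : ℕ+ → Ω → ℕ+,
      (∀ n, ∀ᵐ ω ∂P,
        J n ω ∈ ArgmaxLimit.argmaxSet n (fun j => ArgmaxLimit.scaled c α X n j ω)) →
      TendstoInDistribution (fun (n : ℕ+) (ω : Ω) => ArgmaxLimit.gridPoint n (J n ω)) atTop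
        (id : unitInterval → unitInterval) (fun _ => P) (μ : Measure unitInterval)) := by
  have hcont := hH3.continuousOn_Ioi hF_pos
  refine ⟨ArgmaxLimit.argmaxSet_scaled hc α X, fun J hJ => ?_⟩
  simp only [ArgmaxLimit.argmaxSet_scaled hc α X] at hJ
  have hAm : ∀ n k : ℕ+, MeasurableSet {ω | k ∈ ArgmaxLimit.argmaxSet n fun j => X j ω} := by
    intro n k
    have : {ω | k ∈ ArgmaxLimit.argmaxSet n fun j => X j ω} =
        {_ω | k ≤ n} ∩ ⋂ j, ⋂ _ : j ≤ n, {ω | X j ω ≤ X k ω} := by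
      ext ω
      simp [ArgmaxLimit.argmaxSet]
    rw [this]
    exact (MeasurableSet.const _).inter <| MeasurableSet.iInter fun j =>
      MeasurableSet.iInter fun _ => measurableSet_le (hX_meas j) (hX_meas k)
  have hJA : ∀ n, ∀ᵐ ω ∂P, ∀ k,
      ω ∈ {ω | k ∈ ArgmaxLimit.argmaxSet n fun j => X j ω} ↔ J n ω = k := by
    intro n
    filter_upwards [hJ n, ArgmaxLimit.ae_injective hX_meas hX_indep hX_pos hcont] with ω h hinj k
    constructor
    · exact fun hk => hinj (le_antisymm (hk.2 _ h.1) (h.2 _ hk.1))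
    · rintro rfl
      exact h
  have hJS : ∀ n, ∀ᵐ ω ∂P, J n ω ∈ Finset.Icc 1 n := fun n => by
    filter_upwards [hJ n] with ω h
    exact Finset.mem_Icc.mpr ⟨one_le, h.1⟩
  have hae : ∀ n, AEMeasurable (fun ω => ArgmaxLimit.gridPoint n (J n ω)) P := fun n =>
    (ArgmaxLimit.nullMeasurable_comp_of_ae_mem_iff (hAm n) (hJA n) _).aemeasurable
  have hid : AEMeasurable (id : unitInterval → unitInterval) (μ : Measure unitInterval) :=
    aemeasurable_id
  refine ⟨hae, hid, ?_⟩
  refine ProbabilityMeasure.tendsto_iff_forall_integral_tendsto.mpr fun f => ?_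
  change Tendsto (fun n => ∫ x, f x ∂(P.map fun ω => ArgmaxLimit.gridPoint n (J n ω))) atTop
    (𝓝 (∫ x, f x ∂((μ : Measure unitInterval).map id)))
  rw [Measure.map_id]
  have hweight := FiniteMeasure.tendsto_iff_forall_integral_tendsto.mp hH1.tendsto_weight f
  refine tendsto_of_tendsto_of_dist hweight (Metric.tendsto_nhds.mpr fun r hr => ?_)
  obtain ⟨η, hη, hη1, hηr⟩ : ∃ η : ℝ, 0 < η ∧ η < 1 ∧ 2 * η * ‖f‖ < r := by
    have hC := norm_nonneg f
    refine ⟨min (1 / 2) (r / (2 * (‖f‖ + 1))), by positivity,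
      (min_le_left _ _).trans_lt (by norm_num), ?_⟩
    have h1 := min_le_right (1 / 2) (r / (2 * (‖f‖ + 1)))
    rw [le_div_iff₀ (by positivity)] at h1
    have : 0 < min (1 / 2) (r / (2 * (‖f‖ + 1))) := by positivity
    linarith
  filter_upwards [ArgmaxLimit.eventually_le_measure_argmax hX_meas hX_indep hF_pos hc
    hH1.tendsto_sum hH1.tendsto_max hα hH3 hη hη1] with n hn
  have hlaw := ArgmaxLimit.integral_comp_of_ae_mem_iff (hAm n) (hJA n) (hJS n)
  rw [dist_zero_right, Real.norm_of_nonneg dist_nonneg, dist_comm, Real.dist_eq,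
    integral_map (hae n) f.continuous.aestronglyMeasurable,
    hlaw fun k => f (ArgmaxLimit.gridPoint n k),
    ArgmaxLimit.integral_weightMeasure hc n f f.continuous]
  have hd := ArgmaxLimit.d_pos hc n
  refine (ArgmaxLimit.abs_sum_mul_sub_sum_mul_le hη.le (fun k _ => (div_pos (hc k) hd).le) ?_ ?_
    (fun k hk => hn k (Finset.mem_Icc.mp hk).2) fun k _ => f.norm_coe_le_norm _).trans_lt hηr
  · simpa using (hlaw fun _ => 1).symm
  · rw [← Finset.sum_div]
    exact div_self hd.ne'
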